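/- Let $P$ be a probability distribution on a finite set $\mathcal X$, let $\alpha\ge 0$, and let $J=J_n=\lceil|\mathcal X|^{n\alpha}\rceil$. Logarithms are natural; $H$ is Shannon entropy and $D(\cdot\|\cdot)$ Kullback--Leibler divergence. A secret $\mathbf X=(X_1,\dots,X_n)$ has i.i.d. letters with law $P$; write $P_{\mathbf X}$ for its law on $\mathcal X^n$. Let $\mathrm P^{\mathrm{synchr}}_{c,J}=\sum_{\mathbf x\in\mathcal L}P_{\mathbf X}(\mathbf x)$, where $\mathcal L$ is a set of $J$ most likely elements of $\mathcal X^n$ under $P_{\mathbf X}$ (all of $\mathcal X^n$ if $J>|\mathcal X|^n$), and $$E^{\mathrm{synchr}}_{c,\alpha}=\liminf_{n\to\infty}-\tfrac1n\log \mathrm P^{\mathrm{synchr}}_{c,J}.$$ For $\beta\ge0$ let $\hat{\mathbf X}_1,\hat{\mathbf X}_2,\dots$ be i.i.d., independent of $\mathbf X$, with the tilted law $P^{(\beta)}(\mathbf x)=P_{\mathbf X}(\mathbf x)^\beta/\sum_{\mathbf y\in\mathcal X^n}P_{\mathbf X}(\mathbf y)^\beta$ (with $0^0=1$), let $\mathrm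 P^{\mathrm{asynchr}}_{c,J}(\beta)=\Pr\{\inf\{k\ge1:\hat{\mathbf X}_k=\mathbf X\}\le J\}$, and $$E^{\mathrm{asynchr}}_{c,\alpha}(\beta)=\liminf_{n\to\infty}-\tfrac1n\log \mathrm P^{\mathrm{asynchr}}_{c,J}(\beta).$$ Let $t(\alpha)=\min\{D(Q\|P)+H(Q): H(Q)\ge\alpha\log|\mathcal X|\}$, where $Q$ ranges over the probability distributions on $\mathcal X$ ($t(\alpha)=+\infty$ if there is no such $Q$), and let $\mathcal Q(\alpha)=\{Q: D(Q\|P)+H(Q)<t(\alpha)\}$. Then $\inf_{\beta\ge0}E^{\mathrm{asynchr}}_{c,\alpha}(\beta)=E^{\mathrm{synchr}}_{c,\alpha}$. If moreover $\mathcal Q(\alpha)\ne\emptyset$, then the infimum over $\beta$ is attained and $$\min_{\beta\ge0}E^{\mathrm{asynchr}}_{c,\alpha}(\beta)=\inf_{Q\in\mathcal Q(\alpha)}D(Q\|P)=\min_{Q:\,D(Q\|P)+H(Q)\le t(\alpha)}D(Q\|P)=E^{\mathrm{synchr}}_{c,\alpha}.$$ Thus guessing i.i.d. from a tilted distribution is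 asymptotically as good, in the exponent of the success probability, as synchronized guessing. -/

import Mathlib

open MeasureTheory Filter
open scoped ENNReal

namespace Guesswork

noncomputable section

/-! ### Guessing -/

/-- The number of guesses made until the secret `x` is found, when the guesses are
`g 0, g 1, …` (the guess `g j` is the `(j + 1)`-st one); it is `⊤` if `x` is never guessed. -/
def guessNumber {Y : Type*} (x : Y) (g : ℕ → Y) : ℕ∞ :=
  sInf {k : ℕ∞ | ∃ j : ℕ, k = (j : ℕ∞) + 1 ∧ g j = x}

/-- `L` consists of `J` most likely elements of the finite set `Y` under `μ` (of all elements,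
if there are fewer than `J`), ties being broken arbitrarily. -/
def IsMostLikely {Y : Type*} [Fintype Y] [MeasurableSpace Y] (μ : Measure Y) (J : ℕ)
    (L : Finset Y) : Prop :=
  L.card = min J (Fintype.card Y) ∧ ∀ x ∈ L, ∀ y, y ∉ L → μ {y} ≤ μ {x}

theorem exists_isMostLikely {Y : Type*} [Fintype Y] [MeasurableSpace Y] (μ : Measure Y) (J : ℕ) :
    ∃ L : Finset Y, IsMostLikely μ J L := by
  classical
  induction J with
  | zero => exact ⟨∅, by simp [IsMostLikely]⟩
  | succ J ih =>
    obtain ⟨L, hc, hL⟩ := ih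
    by_cases hu : L = Finset.univ
    · refine ⟨L, ?_, hL⟩
      subst hu
      rw [Finset.card_univ] at hc ⊢
      omega
    · have hne : (Finset.univ \ L).Nonempty := by
        rw [Finset.sdiff_nonempty]
        exact fun h => hu (Finset.univ_subset_iff.1 h)
      obtain ⟨a, ha, hmax⟩ := Finset.exists_max_image (Finset.univ \ L) (fun y => μ {y}) hne
      have haL : a ∉ L := (Finset.mem_sdiff.1 ha).2
      refine ⟨insert a L, ?_, ?_⟩
      · have hlt : L.card < Fintype.card Y := by
          rw [← Finset.card_univ]
          exact Finset.card_lt_card (Finset.ssubset_univ_iff.2 hu)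
        rw [Finset.card_insert_of_notMem haL]
        omega
      · intro x hx y hy
        have hyL : y ∉ L := fun h => hy (Finset.mem_insert_of_mem h)
        rcases Finset.mem_insert.1 hx with rfl | hx
        · exact hmax y (by simp [hyL])
        · exact hL x hx y hyL

/-- A list of `J` most likely elements (its probability does not depend on the choice). -/
def mostLikely {Y : Type*} [Fintype Y] [MeasurableSpace Y] (μ : Measure Y) (J : ℕ) : Finset Y :=
  (exists_isMostLikely μ J).choose

theorem mostLikely_spec {Y : Type*} [Fintype Y] [MeasurableSpace Y] (μ : Measure Y) (J : ℕ) :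
    IsMostLikely μ J (mostLikely μ J) :=
  (exists_isMostLikely μ J).choose_spec

/-! ### Tilted distributions -/

/-- The tilted distribution `μ(x)^β / ∑ y, μ(y)^β` on a finite set. -/
def tilt {Y : Type*} [Fintype Y] [MeasurableSpace Y] (β : ℝ) (μ : Measure Y) : Measure Y :=
  ∑ x, ENNReal.ofReal (μ.real {x} ^ β / ∑ y, μ.real {y} ^ β) • Measure.dirac x

instance tilt_isProbabilityMeasure {Y : Type*} [Fintype Y] [MeasurableSpace Y]
    [MeasurableSingletonClass Y] (β : ℝ) (μ : Measure Y) [IsProbabilityMeasure μ] :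
    IsProbabilityMeasure (tilt β μ) := by
  have hnn : ∀ x, 0 ≤ μ.real {x} ^ β := fun x => Real.rpow_nonneg measureReal_nonneg _
  have hpos : 0 < ∑ y, μ.real {y} ^ β := by
    have h1 : ∑ y, μ.real {y} = 1 := by simp
    obtain ⟨y, -, hy⟩ : ∃ y ∈ Finset.univ, μ.real {y} ≠ 0 :=
      Finset.exists_ne_zero_of_sum_ne_zero (by rw [h1]; exact one_ne_zero)
    exact Finset.sum_pos' (fun x _ => hnn x)
      ⟨y, Finset.mem_univ _, Real.rpow_pos_of_pos (lt_of_le_of_ne measureReal_nonneg hy.symm) _⟩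
  refine ⟨?_⟩
  simp only [tilt, Measure.coe_finsetSum, Finset.sum_apply, Measure.smul_apply, measure_univ,
    smul_eq_mul, mul_one]
  rw [← ENNReal.ofReal_sum_of_nonneg (fun x _ => div_nonneg (hnn x) hpos.le), ← Finset.sum_div,
    div_self hpos.ne', ENNReal.ofReal_one]

/-! ### Success probabilities and their exponents -/

section Exponents

variable {X : Type*} [Fintype X] [MeasurableSpace X]

/-- The law `P^n` of a secret of `n` i.i.d. letters with distribution `P`. -/
abbrev secretLaw (P : Measure X) (n : ℕ) : Measure (Fin n → X) :=
  Measure.pi fun _ : Fin n => P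

/-- The number of guesses `J = ⌈|X|^(n α)⌉`. -/
def numGuesses (X : Type*) [Fintype X] (α : ℝ) (n : ℕ) : ℕ :=
  ⌈(Fintype.card X : ℝ) ^ ((n : ℝ) * α)⌉₊

/-- Success probability of synchronized guessers: the probability of the `J` most likely
secrets. -/
def syncSuccess (P : Measure X) [IsProbabilityMeasure P] (n J : ℕ) : ℝ≥0∞ :=
  ∑ x ∈ mostLikely (secretLaw P n) J, secretLaw P n {x}

/-- Success probability of asynchronous guessers: the secret `x` has law `P^n`, the guesses
`g 0, g 1, …` are independent of it and i.i.d. with the tilted distribution of `P^n`,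
and success means that the secret is found within the first `J` guesses. -/
def asyncSuccess [MeasurableSingletonClass X] (P : Measure X) [IsProbabilityMeasure P]
    (β : ℝ) (n J : ℕ) : ℝ≥0∞ :=
  ((secretLaw P n).prod (Measure.infinitePi fun _ : ℕ => tilt β (secretLaw P n)))
    {ω : (Fin n → X) × (ℕ → Fin n → X) | guessNumber ω.1 ω.2 ≤ (J : ℕ∞)}

/-- The exponent `liminf_n -(1/n) log p_n`, with values in the extended reals and `log 0 = -∞`. -/
def exponent (p : ℕ → ℝ≥0∞) : EReal :=
  liminf (fun n : ℕ => -ENNReal.log (p n) / (n : EReal)) atTop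

def syncExponent (P : Measure X) [IsProbabilityMeasure P] (α : ℝ) : EReal :=
  exponent fun n => syncSuccess P n (numGuesses X α n)

def asyncExponent [MeasurableSingletonClass X] (P : Measure X) [IsProbabilityMeasure P]
    (α β : ℝ) : EReal :=
  exponent fun n => asyncSuccess P β n (numGuesses X α n)

/-! ### The set of distributions `𝒬(α)` -/

/-- Kullback-Leibler divergence `D(Q ‖ P)` (natural logarithm). -/
def div (Q : ProbabilityMeasure X) (P : Measure X) : EReal :=
  (InformationTheory.klDiv (Q : Measure X) P : EReal)

/-- Shannon entropy `H(Q)` (natural logarithm). -/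
def entropy (Q : ProbabilityMeasure X) : ℝ :=
  ∑ x, Real.negMulLog ((Q : Measure X).real {x})

/-- The minimal value of `D(Q ‖ P) + H(Q)` subject to `H(Q) ≥ α log |X|`, that is, to the
entropy of `Q` to base `|X|` being at least `α` (it is `⊤` if no `Q` is feasible). -/
def threshold (P : Measure X) (α : ℝ) : EReal :=
  ⨅ (Q : ProbabilityMeasure X) (_ : α * Real.log (Fintype.card X) ≤ entropy Q),
    div Q P + (entropy Q : EReal)

/-- The set `𝒬(α)`. -/
def QSet (P : Measure X) (α : ℝ) : Set (ProbabilityMeasure X) :=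
  {Q | div Q P + (entropy Q : EReal) < threshold P α}

/-- The set `𝒬(α)` with the strict inequality replaced by the weak one. -/
def closedQSet (P : Measure X) (α : ℝ) : Set (ProbabilityMeasure X) :=
  {Q | div Q P + (entropy Q : EReal) ≤ threshold P α}

end Exponents

end

end Guesswork

/-!
Write `p` for the letter probabilities, `m = |X|`, and `c(Q) = D(Q ‖ P) + H(Q)`, which is the cross
entropy `-∑ Q log p`, an affine function of `Q`. By independence, the tilted distribution of words
is the product of the tilted letter distributions `P_β ∝ p ^ β`. Gibbs' inequality applied to `P_β`
reads `H(Q) ≤ β c(Q) + log ∑ p ^ β`, with equality for `Q = P_β`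
(`sum_negMulLog_le_mul_crossEntropy_add`); it carries the whole optimization over `Q`.

Asynchronous guessing is never better than synchronized guessing, since any `J` guesses form a set
of at most `J` words (`asyncSuccess_le_syncSuccess`). It remains to bound some asynchronous
exponents from above and the synchronized exponent from below.

Suppose that `𝒬(α)` is nonempty. By the intermediate value theorem there is a `β ≥ 1` such that
`P_β` has cross entropy at most `t(α)`, and either `β = 1` or the cross entropy equals `t(α)`
(`exists_tilt_crossEntropy_le`). By Gibbs' inequality `P_β` minimizes the divergence subject to
`c(Q) ≤ t(α)` (`div_tiltProb_le`). By concavity of the entropy, `H(P_β) ≤ α log m`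
(`entropy_le_of_mem_closedQSet`), so that `J` guesses suffice to exhaust the words typical for
`P_β`; a change of measure, Jensen's inequality and a variance bound then show that the asynchronous
exponent at `β` is at most `D(P_β ‖ P)` (`asyncExponent_le_of_entropy_le`). Conversely, a Chernoff
bound shows that the synchronized exponent is at least `D(P_β ‖ P)`
(`div_tiltProb_le_syncExponent`), which closes the circle.

If `𝒬(α)` is empty, then the `k` most likely letters satisfy `log k ≥ α log m`
(`le_log_card_of_QSet_eq_empty`), and for `β → ∞` the asynchronous exponents approach
`-log (max p) - α log m`, which is a lower bound for the synchronized exponent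
(`isGLB_asyncExponent_of_QSet_eq_empty`).
-/

namespace Guesswork

/-! ### Cross entropy and Gibbs' inequality -/

/-- The cross entropy `-∑ x, q x log (r x)` of two weight functions on a finite set. It is
meaningful only if `q` vanishes wherever `r` does, as `Real.log 0 = 0`. -/
noncomputable def crossEntropy {X : Type*} [Fintype X] (q r : X → ℝ) : ℝ :=
  -∑ x, q x * Real.log (r x)

theorem crossEntropy_self {X : Type*} [Fintype X] (q : X → ℝ) :
    crossEntropy q q = ∑ x, Real.negMulLog (q x) := by
  simp [crossEntropy, Real.negMulLog, Finset.sum_neg_distrib]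

/-- Gibbs' inequality. -/
theorem sum_negMulLog_le_crossEntropy {X : Type*} [Fintype X] {q r : X → ℝ}
    (hq : ∀ x, 0 ≤ q x) (hr : ∀ x, 0 ≤ r x) (hqr : ∑ x, r x ≤ ∑ x, q x)
    (hac : ∀ x, r x = 0 → q x = 0) :
    ∑ x, Real.negMulLog (q x) ≤ crossEntropy q r := by
  have key : ∀ x, Real.negMulLog (q x) + q x * Real.log (r x) ≤ r x - q x := by
    intro x
    rcases (hq x).eq_or_lt with h | h
    · simpa [← h] using hr x
    · have hrx : 0 < r x := lt_of_le_of_ne (hr x) fun h0 => h.ne' (hac x h0.symm)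
      have h1 := Real.log_le_sub_one_of_pos (div_pos hrx h)
      rw [Real.log_div hrx.ne' h.ne'] at h1
      have h2 := mul_le_mul_of_nonneg_left h1 h.le
      have h3 : q x * (r x / q x - 1) = r x - q x := by field_simp
      rw [h3] at h2
      rw [Real.negMulLog]
      linarith
  have := Finset.sum_le_sum fun x (_ : x ∈ Finset.univ) => key x
  rw [Finset.sum_add_distrib, Finset.sum_sub_distrib] at this
  rw [crossEntropy]
  linarith

theorem sum_negMulLog_le_log_card {X : Type*} [Fintype X] {q : X → ℝ}
    (hq : ∀ x, 0 ≤ q x) (hq1 : ∑ x, q x = 1) :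
    ∑ x, Real.negMulLog (q x) ≤ Real.log (Fintype.card X) := by
  have hX : (Fintype.card X : ℝ) ≠ 0 := by
    intro h
    have : IsEmpty X := Fintype.card_eq_zero_iff.1 (by exact_mod_cast h)
    simp at hq1
  refine (sum_negMulLog_le_crossEntropy (r := fun _ => (Fintype.card X : ℝ)⁻¹) hq
    (fun _ => by positivity) ?_ fun x h => absurd h (inv_ne_zero hX)).trans_eq ?_
  · rw [hq1, Finset.sum_const, Finset.card_univ, nsmul_eq_mul, mul_inv_cancel₀ hX]
  · rw [crossEntropy, ← Finset.sum_mul, hq1, Real.log_inv]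
    ring

/-! ### Tilted weights -/

/-- The weights `p x ^ β / ∑ y, p y ^ β` of the tilted distribution. -/
noncomputable def tiltWeight {X : Type*} [Fintype X] (β : ℝ) (p : X → ℝ) (x : X) : ℝ :=
  p x ^ β / ∑ y, p y ^ β

section TiltWeight

variable {X : Type*} [Fintype X] {p : X → ℝ}

theorem sum_rpow_pos (hp : ∀ x, 0 ≤ p x) (hp1 : ∑ x, p x = 1) (β : ℝ) : 0 < ∑ x, p x ^ β := by
  obtain ⟨y, -, hy⟩ : ∃ y ∈ Finset.univ, p y ≠ 0 :=
    Finset.exists_ne_zero_of_sum_ne_zero (by rw [hp1]; exact one_ne_zero)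
  exact Finset.sum_pos' (fun x _ => Real.rpow_nonneg (hp x) _)
    ⟨y, Finset.mem_univ _, Real.rpow_pos_of_pos (lt_of_le_of_ne (hp y) hy.symm) _⟩

theorem tiltWeight_nonneg (hp : ∀ x, 0 ≤ p x) (β : ℝ) (x : X) : 0 ≤ tiltWeight β p x :=
  div_nonneg (Real.rpow_nonneg (hp x) _) (Finset.sum_nonneg fun y _ => Real.rpow_nonneg (hp y) _)

theorem sum_tiltWeight (hp : ∀ x, 0 ≤ p x) (hp1 : ∑ x, p x = 1) (β : ℝ) :
    ∑ x, tiltWeight β p x = 1 := by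
  simp only [tiltWeight]
  rw [← Finset.sum_div, div_self (sum_rpow_pos hp hp1 β).ne']

theorem tiltWeight_eq_zero_iff (hp : ∀ x, 0 ≤ p x) (hp1 : ∑ x, p x = 1) {β : ℝ} (hβ : β ≠ 0)
    (x : X) : tiltWeight β p x = 0 ↔ p x = 0 := by
  rw [tiltWeight, div_eq_zero_iff, or_iff_left (sum_rpow_pos hp hp1 β).ne',
    Real.rpow_eq_zero (hp x) hβ]

theorem tiltWeight_one (hp1 : ∑ x, p x = 1) : tiltWeight 1 p = p := by
  funext x
  simp [tiltWeight, hp1]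

/-- Up to a constant, the cross entropy with respect to a tilted distribution is a multiple of the
original one. -/
theorem crossEntropy_tiltWeight (hp : ∀ x, 0 ≤ p x) (hp1 : ∑ x, p x = 1) {q : X → ℝ}
    (hq1 : ∑ x, q x = 1) (hac : ∀ x, p x = 0 → q x = 0) (β : ℝ) :
    crossEntropy q (tiltWeight β p) = β * crossEntropy q p + Real.log (∑ x, p x ^ β) := by
  have h : ∀ x, q x * Real.log (tiltWeight β p x)
      = β * (q x * Real.log (p x)) - q x * Real.log (∑ x, p x ^ β) := by
    intro x
    by_cases hx : p x = 0
    · simp [hac x hx]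
    · have hpos : 0 < p x := lt_of_le_of_ne (hp x) (Ne.symm hx)
      rw [tiltWeight, Real.log_div (Real.rpow_pos_of_pos hpos _).ne' (sum_rpow_pos hp hp1 β).ne',
        Real.log_rpow hpos]
      ring
  simp only [crossEntropy, h]
  rw [Finset.sum_sub_distrib, ← Finset.mul_sum, ← Finset.sum_mul, hq1]
  ring

theorem sum_negMulLog_tiltWeight (hp : ∀ x, 0 ≤ p x) (hp1 : ∑ x, p x = 1) {β : ℝ} (hβ : β ≠ 0) :
    ∑ x, Real.negMulLog (tiltWeight β p x)
      = β * crossEntropy (tiltWeight β p) p + Real.log (∑ x, p x ^ β) := by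
  rw [← crossEntropy_self, crossEntropy_tiltWeight hp hp1 (sum_tiltWeight hp hp1 β)
    fun x => (tiltWeight_eq_zero_iff hp hp1 hβ x).2]

/-- Gibbs' inequality for tilted distributions: among the distributions of a given cross entropy,
the tilted ones maximize the entropy. -/
theorem sum_negMulLog_le_mul_crossEntropy_add (hp : ∀ x, 0 ≤ p x) (hp1 : ∑ x, p x = 1) {q : X → ℝ}
    (hq : ∀ x, 0 ≤ q x) (hq1 : ∑ x, q x = 1) (hac : ∀ x, p x = 0 → q x = 0) {β : ℝ} (hβ : β ≠ 0) :
    ∑ x, Real.negMulLog (q x) ≤ β * crossEntropy q p + Real.log (∑ x, p x ^ β) := by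
  rw [← crossEntropy_tiltWeight hp hp1 hq1 hac]
  exact sum_negMulLog_le_crossEntropy hq (tiltWeight_nonneg hp β)
    (by rw [sum_tiltWeight hp hp1, hq1])
    fun x h => hac x ((tiltWeight_eq_zero_iff hp hp1 hβ x).1 h)

theorem continuousOn_crossEntropy_tiltWeight (hp : ∀ x, 0 ≤ p x) (hp1 : ∑ x, p x = 1) :
    ContinuousOn (fun β => crossEntropy (tiltWeight β p) p) (Set.Ioi 0) := by
  have h : ∀ x, ContinuousOn (fun β : ℝ => p x ^ β) (Set.Ioi 0) := fun x β hβ =>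
    (Real.continuousAt_const_rpow' (ne_of_gt hβ)).continuousWithinAt
  simp only [crossEntropy, tiltWeight]
  refine (continuousOn_finsetSum _ fun x _ => ?_).neg
  exact ((h x).div (continuousOn_finsetSum _ fun y _ => h y)
    fun β _ => (sum_rpow_pos hp hp1 β).ne').mul continuousOn_const

/-- Large tilts push the cross entropy below that of any given competitor, up to an arbitrarily
small error. -/
theorem crossEntropy_tiltWeight_le (hp : ∀ x, 0 ≤ p x) (hp1 : ∑ x, p x = 1) {q : X → ℝ}
    (hq : ∀ x, 0 ≤ q x) (hq1 : ∑ x, q x = 1) (hac : ∀ x, p x = 0 → q x = 0) {β : ℝ} (hβ : 0 < β) :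
    crossEntropy (tiltWeight β p) p ≤ crossEntropy q p + Real.log (Fintype.card X) / β := by
  have h1 := sum_negMulLog_le_mul_crossEntropy_add hp hp1 hq hq1 hac hβ.ne'
  have h2 := sum_negMulLog_tiltWeight hp hp1 hβ.ne'
  have h3 := sum_negMulLog_le_log_card (tiltWeight_nonneg hp β) (sum_tiltWeight hp hp1 β)
  have h4 : 0 ≤ ∑ x, Real.negMulLog (q x) := Finset.sum_nonneg fun x _ =>
    Real.negMulLog_nonneg (hq x)
      (hq1 ▸ Finset.single_le_sum (fun y _ => hq y) (Finset.mem_univ x))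
  rw [← sub_le_iff_le_add', le_div_iff₀ hβ]
  linarith

end TiltWeight

/-! ### Sums over words of i.i.d. letters -/

section Words

variable {X : Type*} [Fintype X] {w : X → ℝ}

theorem sum_prod_eq_one (hw1 : ∑ a, w a = 1) (n : ℕ) :
    ∑ x : Fin n → X, ∏ i, w (x i) = 1 := by
  rw [← Fintype.sum_pow, hw1, one_pow]

theorem sum_word_succ {n : ℕ} (F : (Fin (n + 1) → X) → ℝ) :
    ∑ x, F x = ∑ a, ∑ x : Fin n → X, F (Fin.cons a x) := by
  rw [← Fintype.sum_prod_type' (f := fun a (x : Fin n → X) => F (Fin.cons a x))]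
  exact (Fintype.sum_equiv (Fin.consEquiv fun _ => X) _ _ fun _ => rfl).symm

/-- The mean of a sum of i.i.d. terms. -/
theorem sum_prod_mul_sum (hw1 : ∑ a, w a = 1) (f : X → ℝ) (n : ℕ) :
    ∑ x : Fin n → X, (∏ i, w (x i)) * ∑ i, f (x i) = n * ∑ a, w a * f a := by
  induction n with
  | zero => simp
  | succ n ih =>
    have h : ∀ a (x : Fin n → X), (w a * ∏ i, w (x i)) * (f a + ∑ i, f (x i))
        = (w a * f a) * (∏ i, w (x i)) + w a * ((∏ i, w (x i)) * ∑ i, f (x i)) :=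
      fun a x => by ring
    rw [sum_word_succ]
    simp only [Fin.prod_univ_succ, Fin.sum_univ_succ, Fin.cons_zero, Fin.cons_succ, h,
      Finset.sum_add_distrib, ← Finset.mul_sum, ih, sum_prod_eq_one hw1]
    rw [← Finset.sum_mul, ← Finset.sum_mul, hw1]
    push_cast
    ring

/-- The variance of a sum of centred i.i.d. terms. -/
theorem sum_prod_mul_sum_sq (hw1 : ∑ a, w a = 1) {f : X → ℝ} (hf : ∑ a, w a * f a = 0) (n : ℕ) :
    ∑ x : Fin n → X, (∏ i, w (x i)) * (∑ i, f (x i)) ^ 2 = n * ∑ a, w a * f a ^ 2 := by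
  induction n with
  | zero => simp
  | succ n ih =>
    have h : ∀ a (x : Fin n → X), (w a * ∏ i, w (x i)) * (f a + ∑ i, f (x i)) ^ 2
        = (w a * f a ^ 2) * (∏ i, w (x i)) + (2 * (w a * f a)) * ((∏ i, w (x i)) * ∑ i, f (x i))
          + w a * ((∏ i, w (x i)) * (∑ i, f (x i)) ^ 2) :=
      fun a x => by ring
    rw [sum_word_succ]
    simp only [Fin.prod_univ_succ, Fin.sum_univ_succ, Fin.cons_zero, Fin.cons_succ, h,
      Finset.sum_add_distrib, ← Finset.mul_sum, ih, sum_prod_eq_one hw1, sum_prod_mul_sum hw1, hf]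
    simp only [mul_zero, Finset.sum_const_zero, ← Finset.sum_mul, hw1]
    push_cast
    ring

theorem tiltWeight_prod (hw : ∀ a, 0 ≤ w a) (β : ℝ) {n : ℕ} (x : Fin n → X) :
    tiltWeight β (fun y : Fin n → X => ∏ i, w (y i)) x = ∏ i, tiltWeight β w (x i) := by
  have h : ∀ y : Fin n → X, (∏ i, w (y i)) ^ β = ∏ i, w (y i) ^ β := fun y =>
    (Real.finsetProd_rpow _ _ (fun i _ => hw _) β).symm
  simp only [tiltWeight, h]
  rw [Finset.prod_div_distrib, ← Fintype.sum_pow (fun a => w a ^ β) n, Finset.prod_const,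
    Finset.card_univ, Fintype.card_fin]

end Words

/-! ### Bounds on the success probabilities -/

/-- The probability that one of `J` independent attempts succeeds is at least half the union
bound (truncated at `1`). -/
theorem min_div_two_le_one_sub_pow {q : ℝ} (hq1 : q ≤ 1) (J : ℕ) (hq : 0 ≤ q) :
    min 1 (J * q) / 2 ≤ 1 - (1 - q) ^ J := by
  have h0 : (1 - q) ^ J ≤ Real.exp (-(J * q)) := by
    have := pow_le_pow_left₀ (sub_nonneg.2 hq1) (Real.one_sub_le_exp_neg q) J
    rwa [← Real.exp_nat_mul, mul_neg] at this
  have hu : 0 ≤ J * q := by positivity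
  have h1 : Real.exp (-(J * q)) ≤ (1 + J * q)⁻¹ := by
    rw [Real.exp_neg]
    exact inv_anti₀ (by positivity) (by linarith [Real.add_one_le_exp (J * q)])
  have h2 : min 1 (J * q) / 2 ≤ 1 - (1 + J * q)⁻¹ := by
    have h3 : 1 - (1 + J * q)⁻¹ = (J * q) / (1 + J * q) := by field_simp; ring
    rw [h3, div_le_div_iff₀ two_pos (by positivity)]
    rcases le_total 1 (J * q) with h | h
    · rw [min_eq_left h]; linarith
    · rw [min_eq_right h]; nlinarith
  linarith

/-- If `J` guesses suffice to exhaust the words that are typical under `r`, then i.i.d. guesses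
from `r` find a `p`-distributed secret with an exponent of at most the divergence of `r` from `p`.
The proof changes the measure from `p` to `r`, pulls the exponential out by Jensen's inequality,
and bounds the fluctuations of the information content of a word by their variance. -/
theorem exp_le_sum_prod_mul_one_sub_pow {X : Type*} [Fintype X] {p r : X → ℝ}
    (hp : ∀ a, 0 ≤ p a) (hr : ∀ a, 0 ≤ r a) (hr1 : ∑ a, r a = 1) (hac : ∀ a, p a = 0 → r a = 0)
    {n J : ℕ} (hJ : Real.exp (n * ∑ a, Real.negMulLog (r a)) ≤ J) :
    Real.exp (-(n * (crossEntropy r p - ∑ a, Real.negMulLog (r a)) + √n *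
        ((∑ a, r a * (-Real.log (r a) - ∑ a, Real.negMulLog (r a)) ^ 2 + 1) / 2))) / 2
      ≤ ∑ x : Fin n → X, (∏ i, p (x i)) * (1 - (1 - ∏ i, r (x i)) ^ J) := by
  set H : ℝ := ∑ a, Real.negMulLog (r a) with hH
  set f : X → ℝ := fun a => -Real.log (r a) - H with hf
  set d : X → ℝ := fun a => Real.log (r a) - Real.log (p a) with hd
  set V : ℝ := ∑ a, r a * f a ^ 2 with hV
  have hf0 : ∑ a, r a * f a = 0 := by
    simp only [hf, mul_sub, Finset.sum_sub_distrib, ← Finset.sum_mul, hr1, hH, Real.negMulLog]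
    simp
  have hd1 : ∑ a, r a * d a = crossEntropy r p - H := by
    simp only [hd, mul_sub, Finset.sum_sub_distrib, hH, Real.negMulLog, crossEntropy]
    simp [Finset.sum_neg_distrib]
    ring
  set φ : (Fin n → X) → ℝ := fun x => ∑ i, d (x i) + |∑ i, f (x i)| with hφ
  have hw : ∀ x : Fin n → X, 0 ≤ ∏ i, r (x i) := fun x => Finset.prod_nonneg fun i _ => hr _
  -- the exponent in Jensen's inequality
  have hmean : ∑ x : Fin n → X, (∏ i, r (x i)) * φ x
      ≤ n * (crossEntropy r p - H) + √n * ((V + 1) / 2) := by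
    -- An inequality of arithmetic and geometric means, which reduces `E |S|` to `E S ^ 2`.
    have habs : ∀ s : ℝ, √n * |s| ≤ (s ^ 2 + n) / 2 := fun s => by
      have := sq_nonneg (|s| - √n)
      rw [sub_sq, sq_abs, Real.sq_sqrt n.cast_nonneg] at this
      linarith
    have h1 : √n * ∑ x : Fin n → X, (∏ i, r (x i)) * |∑ i, f (x i)| ≤ n * ((V + 1) / 2) := by
      rw [Finset.mul_sum]
      calc ∑ x : Fin n → X, √n * ((∏ i, r (x i)) * |∑ i, f (x i)|)
          ≤ ∑ x : Fin n → X, (((∏ i, r (x i)) * (∑ i, f (x i)) ^ 2) / 2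
              + (∏ i, r (x i)) * (n / 2)) := by
            refine Finset.sum_le_sum fun x _ => ?_
            have := mul_le_mul_of_nonneg_left (habs (∑ i, f (x i))) (hw x)
            linarith
        _ = n * ((V + 1) / 2) := by
            rw [Finset.sum_add_distrib, ← Finset.sum_div, ← Finset.sum_mul,
              sum_prod_mul_sum_sq hr1 hf0, sum_prod_eq_one hr1]
            ring
    have h2 : ∑ x : Fin n → X, (∏ i, r (x i)) * |∑ i, f (x i)| ≤ √n * ((V + 1) / 2) := by
      rcases Nat.eq_zero_or_pos n with rfl | hn
      · simp
      · have hs : 0 < √(n : ℝ) := Real.sqrt_pos.2 (by exact_mod_cast hn)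
        refine le_of_mul_le_mul_left (h1.trans_eq ?_) hs
        rw [← mul_assoc, Real.mul_self_sqrt n.cast_nonneg]
    simp only [hφ, mul_add, Finset.sum_add_distrib, sum_prod_mul_sum hr1, hd1]
    linarith
  have hjensen : Real.exp (-∑ x : Fin n → X, (∏ i, r (x i)) * φ x)
      ≤ ∑ x : Fin n → X, (∏ i, r (x i)) * Real.exp (-φ x) := by
    have := convexOn_exp.map_sum_le (t := Finset.univ) (w := fun x : Fin n → X => ∏ i, r (x i))
      (p := fun x => -φ x) (fun x _ => hw x) (sum_prod_eq_one hr1 n) fun _ _ => Set.mem_univ _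
    simpa [Finset.sum_neg_distrib] using this
  have hpoint : ∀ x : Fin n → X, (∏ i, r (x i)) * Real.exp (-φ x) / 2
      ≤ (∏ i, p (x i)) * (1 - (1 - ∏ i, r (x i)) ^ J) := by
    intro x
    have hle1 : ∏ i, r (x i) ≤ 1 := Finset.prod_le_one (fun i _ => hr _) fun i _ =>
      hr1 ▸ Finset.single_le_sum (fun y _ => hr y) (Finset.mem_univ (x i))
    have hmin := min_div_two_le_one_sub_pow hle1 J (hw x)
    have hpx : 0 ≤ ∏ i, p (x i) := Finset.prod_nonneg fun i _ => hp _
    rcases (hw x).eq_or_lt with h0 | h0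
    · rw [← h0]; simp
    · have hri : ∀ i, 0 < r (x i) := fun i => lt_of_le_of_ne (hr _) fun h =>
        h0.ne' (Finset.prod_eq_zero (Finset.mem_univ i) h.symm)
      have hpi : ∀ i, 0 < p (x i) := fun i => lt_of_le_of_ne (hp _) fun h =>
        (hri i).ne' (hac _ h.symm)
      have hrexp : ∏ i, r (x i) = Real.exp (-∑ i, f (x i) - n * H) := by
        rw [← Real.exp_log h0, Real.log_prod fun i _ => (hri i).ne']
        congr 1
        simp [hf, Finset.sum_sub_distrib, Finset.sum_neg_distrib]
      have hpexp : ∏ i, p (x i) = (∏ i, r (x i)) * Real.exp (-∑ i, d (x i)) := by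
        rw [← Finset.sum_neg_distrib, Real.exp_sum, ← Finset.prod_mul_distrib]
        refine Finset.prod_congr rfl fun i _ => ?_
        rw [hd]
        simp only [neg_sub]
        rw [Real.exp_sub, Real.exp_log (hpi i), Real.exp_log (hri i),
          mul_div_cancel₀ _ (hri i).ne']
      have hmin' : Real.exp (-|∑ i, f (x i)|) ≤ min 1 (J * ∏ i, r (x i)) := by
        refine le_min (Real.exp_le_one_iff.2 (neg_nonpos.2 (abs_nonneg _))) ?_
        refine le_trans ?_ (mul_le_mul_of_nonneg_right hJ (hw x))
        rw [hrexp, ← Real.exp_add]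
        refine Real.exp_le_exp.2 ?_
        linarith [le_abs_self (∑ i, f (x i))]
      calc (∏ i, r (x i)) * Real.exp (-φ x) / 2
          = (∏ i, p (x i)) * (Real.exp (-|∑ i, f (x i)|) / 2) := by
            rw [hpexp, hφ]
            simp only [neg_add]
            rw [Real.exp_add]
            ring
        _ ≤ _ := mul_le_mul_of_nonneg_left (by linarith) hpx
  calc _ ≤ Real.exp (-∑ x : Fin n → X, (∏ i, r (x i)) * φ x) / 2 := by
        have := Real.exp_le_exp.2 (neg_le_neg hmean)
        linarith
    _ ≤ (∑ x : Fin n → X, (∏ i, r (x i)) * Real.exp (-φ x)) / 2 := by linarith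
    _ ≤ _ := by
        rw [Finset.sum_div]
        exact Finset.sum_le_sum fun x _ => hpoint x

/-- Chernoff-type bound on the probability of a set of words of given size. -/
theorem sum_prod_le_card_mul_add {X : Type*} [Fintype X] {p : X → ℝ} (hp : ∀ a, 0 ≤ p a)
    {β : ℝ} (hβ : 1 ≤ β) {n : ℕ} (L : Finset (Fin n → X)) (t : ℝ) :
    ∑ x ∈ L, ∏ i, p (x i)
      ≤ L.card * Real.exp (-(n * t)) + Real.exp (n * ((β - 1) * t)) * (∑ a, p a ^ β) ^ n := by
  have hpx : ∀ x : Fin n → X, 0 ≤ ∏ i, p (x i) := fun x => Finset.prod_nonneg fun i _ => hp _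
  have hpoint : ∀ x : Fin n → X, ∏ i, p (x i)
      ≤ Real.exp (-(n * t)) + Real.exp (n * ((β - 1) * t)) * ∏ i, p (x i) ^ β := by
    intro x
    rw [Real.finsetProd_rpow _ _ (fun i _ => hp _)]
    set u := ∏ i, p (x i)
    -- A factor `(u * exp (n t)) ^ (β - 1) ≥ 1` may be inserted where `u` exceeds `exp (-(n t))`.
    rcases le_total u (Real.exp (-(n * t))) with h | h
    · have : 0 ≤ u ^ β := Real.rpow_nonneg (hpx x) _
      have := mul_nonneg (Real.exp_pos (n * ((β - 1) * t))).le this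
      linarith
    · have hu : 0 < u := (Real.exp_pos _).trans_le h
      have h1 : Real.exp (-(n * t)) ^ (β - 1) ≤ u ^ (β - 1) :=
        Real.rpow_le_rpow (Real.exp_pos _).le h (by linarith)
      have h2 : u ^ β = u ^ (β - 1) * u := by
        rw [← Real.rpow_add_one hu.ne', sub_add_cancel]
      have h3 : u = Real.exp (n * ((β - 1) * t)) * (Real.exp (-(n * t)) ^ (β - 1) * u) := by
        rw [← Real.exp_mul, ← mul_assoc, ← Real.exp_add,
          show (n : ℝ) * ((β - 1) * t) + -(n * t) * (β - 1) = 0 by ring, Real.exp_zero, one_mul]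
      have h4 := mul_le_mul_of_nonneg_left (mul_le_mul_of_nonneg_right h1 hu.le)
        (Real.exp_pos (n * ((β - 1) * t))).le
      rw [← h3, ← h2] at h4
      linarith [Real.exp_pos (-(n * t))]
  calc ∑ x ∈ L, ∏ i, p (x i)
      ≤ ∑ x ∈ L, (Real.exp (-(n * t)) + Real.exp (n * ((β - 1) * t)) * ∏ i, p (x i) ^ β) :=
        Finset.sum_le_sum fun x _ => hpoint x
    _ = L.card * Real.exp (-(n * t))
          + Real.exp (n * ((β - 1) * t)) * ∑ x ∈ L, ∏ i, p (x i) ^ β := by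
        rw [Finset.sum_add_distrib, Finset.sum_const, nsmul_eq_mul, Finset.mul_sum]
    _ ≤ _ := by
        rw [Fintype.sum_pow (fun a => p a ^ β) n]
        gcongr
        · exact fun x _ _ => Finset.prod_nonneg fun i _ => Real.rpow_nonneg (hp _) _
        · exact Finset.subset_univ L

/-! ### Distributions on a finite set and their weights -/

section Weights

variable {X : Type*} [MeasurableSpace X]

/-- The probability of a letter, as a real number. -/
noncomputable def weight (μ : Measure X) (x : X) : ℝ := μ.real {x}

theorem weight_nonneg (μ : Measure X) (x : X) : 0 ≤ weight μ x := measureReal_nonneg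

theorem weight_le_one (μ : Measure X) [IsProbabilityMeasure μ] (x : X) : weight μ x ≤ 1 :=
  measureReal_le_one

theorem div_eq_top (Q : ProbabilityMeasure X) (P : Measure X) (h : ¬ (Q : Measure X) ≪ P) :
    div Q P = ⊤ := by
  rw [div, InformationTheory.klDiv_of_not_ac h]
  rfl

variable [Fintype X]

theorem div_add_entropy_eq_top (Q : ProbabilityMeasure X) (P : Measure X)
    (h : ¬ (Q : Measure X) ≪ P) : div Q P + (entropy Q : EReal) = ⊤ := by
  rw [div_eq_top Q P h, EReal.top_add_coe]

theorem absolutelyContinuous_iff_weight (Q P : Measure X) [IsFiniteMeasure Q]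
    [IsFiniteMeasure P] : Q ≪ P ↔ ∀ x, weight P x = 0 → weight Q x = 0 := by
  simp only [weight]
  constructor
  · intro h x hx
    rw [measureReal_eq_zero_iff] at hx ⊢
    exact h hx
  · intro h s hs
    rw [← Set.biUnion_of_singleton s, measure_biUnion_null_iff s.to_countable]
    intro x hx
    have := h x ((measureReal_eq_zero_iff).2 (measure_mono_null (Set.singleton_subset_iff.2 hx) hs))
    rwa [measureReal_eq_zero_iff] at this

variable [MeasurableSingletonClass X]

theorem sum_weight (μ : Measure X) [IsProbabilityMeasure μ] :
    ∑ x, weight μ x = 1 := by simp [weight]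

theorem exists_probabilityMeasure_weight_eq {q : X → ℝ} (hq : ∀ x, 0 ≤ q x) (hq1 : ∑ x, q x = 1) :
    ∃ Q : ProbabilityMeasure X, ∀ x, weight (Q : Measure X) x = q x := by
  have h1 : ∑ x, ENNReal.ofReal (q x) = 1 := by
    rw [← ENNReal.ofReal_sum_of_nonneg fun x _ => hq x, hq1, ENNReal.ofReal_one]
  refine ⟨⟨(PMF.ofFintype (fun x => ENNReal.ofReal (q x)) h1).toMeasure, inferInstance⟩,
    fun x => ?_⟩
  rw [weight, Measure.real, ProbabilityMeasure.coe_mk,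
    PMF.toMeasure_apply_singleton _ _ (measurableSet_singleton x), PMF.ofFintype_apply,
    ENNReal.toReal_ofReal (hq x)]

theorem weight_tilt (β : ℝ) (μ : Measure X) (x : X) :
    weight (tilt β μ) x = tiltWeight β (weight μ) x := by
  classical
  have h : ∀ y, (Measure.dirac y : Measure X) {x} = if y = x then 1 else 0 := fun y => by
    simp [Measure.dirac_apply' _ (measurableSet_singleton x), Set.indicator_apply]
  simp only [weight, Measure.real, tilt, Measure.coe_finsetSum, Finset.sum_apply,
    Measure.smul_apply, smul_eq_mul, h, mul_ite, mul_one, mul_zero,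
    Finset.sum_ite_eq', Finset.mem_univ, if_true]
  exact ENNReal.toReal_ofReal (tiltWeight_nonneg (weight_nonneg μ) β x)

theorem integral_llr_eq {Q P : Measure X} [IsProbabilityMeasure Q] [IsProbabilityMeasure P]
    (h : Q ≪ P) : ∫ x, llr Q P x ∂Q
      = crossEntropy (weight Q) (weight P)
        - ∑ x, Real.negMulLog (weight Q x) := by
  rw [integral_fintype (Integrable.of_finite)]
  simp only [crossEntropy, weight, Real.negMulLog, neg_mul, Finset.sum_neg_distrib]
  rw [sub_neg_eq_add, neg_add_eq_sub, ← Finset.sum_sub_distrib]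
  refine Finset.sum_congr rfl fun x _ => ?_
  by_cases hx : Q.real {x} = 0
  · simp [hx]
  · have hP : P.real {x} ≠ 0 := fun h0 =>
      hx ((absolutelyContinuous_iff_weight Q P).1 h x h0)
    have hd : Q.real {x} = (Q.rnDeriv P x).toReal * P.real {x} := by
      have := Measure.setLIntegral_rnDeriv h {x}
      rw [lintegral_singleton] at this
      rw [Measure.real, ← this, ENNReal.toReal_mul, Measure.real]
    have hr : (Q.rnDeriv P x).toReal ≠ 0 := fun h0 => hx (by rw [hd, h0, zero_mul])
    have hl : Real.log (Q.real {x}) = llr Q P x + Real.log (P.real {x}) := by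
      rw [llr, hd, Real.log_mul hr hP]
    rw [hl, smul_eq_mul]
    ring

theorem div_eq_of_ac (Q : ProbabilityMeasure X) (P : Measure X) [IsProbabilityMeasure P]
    (h : (Q : Measure X) ≪ P) :
    div Q P = ((crossEntropy (weight (Q : Measure X)) (weight P)
      - entropy Q : ℝ) : EReal) := by
  have hnn := InformationTheory.integral_llr_add_sub_measure_univ_nonneg h Integrable.of_finite
  rw [div, InformationTheory.klDiv_of_ac_of_integrable h Integrable.of_finite,
    EReal.coe_ennreal_ofReal, max_eq_left hnn, integral_llr_eq h, probReal_univ, probReal_univ,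
    add_sub_cancel_right]
  rfl

theorem div_add_entropy_of_ac (Q : ProbabilityMeasure X) (P : Measure X) [IsProbabilityMeasure P]
    (h : (Q : Measure X) ≪ P) : div Q P + (entropy Q : EReal)
      = (crossEntropy (weight (Q : Measure X)) (weight P) : ℝ) := by
  rw [div_eq_of_ac Q P h, ← EReal.coe_add, sub_add_cancel]

end Weights

/-! ### The success probabilities as finite sums -/

theorem guessNumber_le_iff {Y : Type*} (x : Y) (g : ℕ → Y) (J : ℕ) :
    guessNumber x g ≤ (J : ℕ∞) ↔ ∃ j < J, g j = x := by
  rw [guessNumber, ← ENat.lt_add_one_iff (ENat.natCast_ne_top J), sInf_lt_iff]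
  constructor
  · rintro ⟨k, ⟨j, rfl, hj⟩, hk⟩
    exact ⟨j, Nat.lt_of_add_lt_add_right (n := 1) (by exact_mod_cast hk), hj⟩
  · rintro ⟨j, hj, hx⟩
    exact ⟨_, ⟨j, rfl, hx⟩, by exact_mod_cast Nat.add_lt_add_right hj 1⟩

theorem measurableSet_guessNumber_le {Y : Type*} [Finite Y] [MeasurableSpace Y]
    [MeasurableSingletonClass Y] (J : ℕ) :
    MeasurableSet {ω : Y × (ℕ → Y) | guessNumber ω.1 ω.2 ≤ (J : ℕ∞)} := by
  have h : {ω : Y × (ℕ → Y) | guessNumber ω.1 ω.2 ≤ (J : ℕ∞)}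
      = ⋃ j ∈ Set.Iio J, ⋃ x : Y, {x} ×ˢ ((fun g : ℕ → Y => g j) ⁻¹' {x}) := by
    ext ⟨x, g⟩
    simp [guessNumber_le_iff]
  rw [h]
  exact MeasurableSet.biUnion (Set.to_countable _) fun j _ => MeasurableSet.iUnion fun x =>
    (measurableSet_singleton x).prod (measurable_pi_apply j (measurableSet_singleton x))

/-- No set of at most `J` elements is more likely than a list of `J` most likely elements. -/
theorem IsMostLikely.measure_le {Y : Type*} [Fintype Y] [MeasurableSpace Y]
    [MeasurableSingletonClass Y] {μ : Measure Y} {J : ℕ} {L : Finset Y} (hL : IsMostLikely μ J L)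
    {S : Finset Y} (hS : S.card ≤ J) : μ (S : Set Y) ≤ ∑ x ∈ L, μ {x} := by
  classical
  rw [← sum_measure_singleton, ← Finset.sum_inter_add_sum_sdiff S L,
    ← Finset.sum_inter_add_sum_sdiff L S, Finset.inter_comm L S]
  refine add_le_add_right ?_ _
  have hcard : (S \ L).card ≤ (L \ S).card := by
    have h1 : S.card ≤ L.card := by rw [hL.1]; exact le_min hS (Finset.card_le_univ S)
    have h2 := Finset.card_sdiff_add_card_inter S L
    have h3 := Finset.card_sdiff_add_card_inter L S
    rw [Finset.inter_comm] at h3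
    omega
  set M := (S \ L).sup fun x => μ {x}
  calc ∑ x ∈ S \ L, μ {x} ≤ (S \ L).card • M :=
        Finset.sum_le_card_nsmul _ _ _ fun x hx => Finset.le_sup (f := fun x => μ {x}) hx
    _ ≤ (L \ S).card • M := nsmul_le_nsmul_left zero_le hcard
    _ ≤ ∑ x ∈ L \ S, μ {x} := Finset.card_nsmul_le_sum _ _ _ fun y hy =>
        Finset.sup_le fun x hx =>
          hL.2 y (Finset.mem_sdiff.1 hy).1 x (Finset.mem_sdiff.1 hx).2

section Success

variable {X : Type*} [MeasurableSpace X] (P : Measure X) [IsProbabilityMeasure P]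

theorem weight_secretLaw (n : ℕ) (x : Fin n → X) :
    weight (secretLaw P n) x = ∏ i, weight P (x i) := by
  simp [weight, Measure.real, ENNReal.toReal_prod]

variable [Fintype X]

theorem syncSuccess_eq (n J : ℕ) :
    syncSuccess P n J
      = ENNReal.ofReal (∑ x ∈ mostLikely (secretLaw P n) J, ∏ i, weight P (x i)) := by
  rw [syncSuccess, ENNReal.ofReal_sum_of_nonneg
    fun x _ => Finset.prod_nonneg fun i _ => weight_nonneg P _]
  refine Finset.sum_congr rfl fun x _ => ?_
  rw [← weight_secretLaw, weight, ofReal_measureReal]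

variable [MeasurableSingletonClass X]

/-- Whatever the asynchronous guesses are, they form a set of at most `J` words, which is at most
as likely to contain the secret as the `J` most likely words. -/
theorem asyncSuccess_le_syncSuccess (β : ℝ) (n J : ℕ) :
    asyncSuccess P β n J ≤ syncSuccess P n J := by
  classical
  rw [asyncSuccess, Measure.prod_apply_symm (measurableSet_guessNumber_le J)]
  refine (lintegral_mono (g := fun _ => syncSuccess P n J) fun g => ?_).trans_eq (by simp)
  have h : (fun x : Fin n → X => (x, g)) ⁻¹' {ω | guessNumber ω.1 ω.2 ≤ (J : ℕ∞)}
      = ((Finset.range J).image g : Set (Fin n → X)) := by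
    ext x
    simp [guessNumber_le_iff]
  simp only [h]
  exact (mostLikely_spec (secretLaw P n) J).measure_le
    (Finset.card_image_le.trans_eq (Finset.card_range J))

theorem asyncSuccess_eq (β : ℝ) (n J : ℕ) :
    asyncSuccess P β n J = ENNReal.ofReal (∑ x : Fin n → X, (∏ i, weight P (x i)) *
      (1 - (1 - ∏ i, tiltWeight β (weight P) (x i)) ^ J)) := by
  have hq : ∀ x : Fin n → X, weight (tilt β (secretLaw P n)) x
      = ∏ i, tiltWeight β (weight P) (x i) := fun x => by
    rw [weight_tilt, ← tiltWeight_prod (weight_nonneg P)]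
    congr 1
    exact funext fun y => weight_secretLaw P n y
  have hguess : ∀ x : Fin n → X, (Measure.infinitePi fun _ : ℕ => tilt β (secretLaw P n))
      (Prod.mk x ⁻¹' {ω | guessNumber ω.1 ω.2 ≤ (J : ℕ∞)})
        = ENNReal.ofReal (1 - (1 - ∏ i, tiltWeight β (weight P) (x i)) ^ J) := by
    intro x
    have h : Prod.mk x ⁻¹' {ω : (Fin n → X) × (ℕ → Fin n → X) | guessNumber ω.1 ω.2 ≤ (J : ℕ∞)}
        = (Set.pi (Finset.range J) fun _ => {x}ᶜ)ᶜ := by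
      ext g
      simp [guessNumber_le_iff, Set.mem_pi]
    have hm : MeasurableSet ({x}ᶜ : Set (Fin n → X)) := (measurableSet_singleton x).compl
    rw [h, prob_compl_eq_one_sub (MeasurableSet.pi (Set.to_countable _) fun _ _ => hm),
      Measure.infinitePi_pi _ fun _ _ => hm, Finset.prod_const, Finset.card_range,
      ← ofReal_measureReal, probReal_compl_eq_one_sub (measurableSet_singleton x), ← weight, hq,
      ← ENNReal.ofReal_pow (by rw [← hq]; exact sub_nonneg.2 (weight_le_one _ _)),
      ← ENNReal.ofReal_one, ← ENNReal.ofReal_sub _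
        (pow_nonneg (by rw [← hq]; exact sub_nonneg.2 (weight_le_one _ _)) _)]
  rw [asyncSuccess, Measure.prod_apply (measurableSet_guessNumber_le J), lintegral_fintype,
    ENNReal.ofReal_sum_of_nonneg]
  · refine Finset.sum_congr rfl fun x _ => ?_
    rw [hguess, ENNReal.ofReal_mul (Finset.prod_nonneg fun i _ => weight_nonneg P _),
      ← weight_secretLaw, weight, ofReal_measureReal, mul_comm]
  · intro x _
    refine mul_nonneg (Finset.prod_nonneg fun i _ => weight_nonneg P _) ?_
    rw [← hq]
    exact sub_nonneg.2 (pow_le_one₀ (sub_nonneg.2 (weight_le_one _ _))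
      (sub_le_self _ (weight_nonneg _ _)))

theorem syncSuccess_le_one (n J : ℕ) : syncSuccess P n J ≤ 1 := by
  rw [syncSuccess, sum_measure_singleton]
  exact prob_le_one

end Success

/-! ### Exponents -/

theorem exponent_anti {p q : ℕ → ℝ≥0∞} (h : ∀ n, p n ≤ q n) : exponent q ≤ exponent p := by
  refine liminf_le_liminf (Eventually.of_forall fun n => ?_)
  exact EReal.div_le_div_right_of_nonneg (by positivity)
    (EReal.neg_le_neg_iff.2 (ENNReal.log_monotone (h n)))

/-- The exponent of a sequence of the form `exp (-(n a + o(n)))` is `a`. At `n = 0` both quotients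
have the junk value `0`. -/
theorem exponent_ofReal_exp {u : ℕ → ℝ} {a : ℝ} (hu : Tendsto (fun n => u n / n) atTop (nhds a)) :
    exponent (fun n => ENNReal.ofReal (Real.exp (-u n))) = a := by
  have h : ∀ n : ℕ, -ENNReal.log (ENNReal.ofReal (Real.exp (-u n))) / (n : EReal)
      = ((u n / n : ℝ) : EReal) := fun n => by
    rw [ENNReal.log_ofReal_of_pos (Real.exp_pos _), Real.log_exp, EReal.coe_div,
      EReal.coe_neg, neg_neg]
    rfl
  simp only [exponent, h]
  exact (continuous_coe_real_ereal.tendsto a |>.comp hu).liminf_eq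

theorem le_exponent {p : ℕ → ℝ≥0∞} {a C : ℝ} (hC : 0 < C)
    (h : ∀ n : ℕ, p n ≤ ENNReal.ofReal (C * Real.exp (-(n * a)))) : (a : EReal) ≤ exponent p := by
  have hu : Tendsto (fun n : ℕ => (n * a - Real.log C) / (n : ℝ)) atTop (nhds a) := by
    have h1 : Tendsto (fun n : ℕ => a - Real.log C / (n : ℝ)) atTop (nhds (a - 0)) :=
      tendsto_const_nhds.sub (tendsto_const_div_atTop_nhds_zero_nat _)
    rw [sub_zero] at h1
    refine h1.congr' ?_
    filter_upwards [eventually_gt_atTop 0] with n hn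
    have : (n : ℝ) ≠ 0 := by exact_mod_cast hn.ne'
    field_simp
  rw [← exponent_ofReal_exp hu]
  refine exponent_anti fun n => (h n).trans_eq ?_
  rw [neg_sub, sub_eq_add_neg, Real.exp_add, Real.exp_log hC]

theorem exponent_le {p : ℕ → ℝ≥0∞} {a b C : ℝ} (hC : 0 < C)
    (h : ∀ n : ℕ, ENNReal.ofReal (Real.exp (-(n * a + √n * b)) / C) ≤ p n) :
    exponent p ≤ (a : EReal) := by
  have hu : Tendsto (fun n : ℕ => (n * a + √n * b + Real.log C) / (n : ℝ)) atTop (nhds a) := by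
    have h0 : Tendsto (fun n : ℕ => b / √(n : ℝ)) atTop (nhds 0) :=
      tendsto_const_nhds.div_atTop (Real.tendsto_sqrt_atTop.comp tendsto_natCast_atTop_atTop)
    have h1 : Tendsto (fun n : ℕ => a + b / √(n : ℝ) + Real.log C / (n : ℝ)) atTop
        (nhds (a + 0 + 0)) :=
      (tendsto_const_nhds.add h0).add (tendsto_const_div_atTop_nhds_zero_nat _)
    rw [add_zero, add_zero] at h1
    refine h1.congr' ?_
    filter_upwards [eventually_gt_atTop 0] with n hn
    have hn' : (0 : ℝ) < n := by exact_mod_cast hn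
    have hs : √(n : ℝ) ≠ 0 := (Real.sqrt_pos.2 hn').ne'
    have : b / √(n : ℝ) = √n * b / n := by
      rw [div_eq_div_iff hs hn'.ne', mul_right_comm, Real.mul_self_sqrt hn'.le, mul_comm]
    rw [this]
    field_simp
  rw [← exponent_ofReal_exp hu]
  refine exponent_anti fun n => le_of_eq_of_le ?_ (h n)
  rw [neg_add _ (Real.log C), Real.exp_add, Real.exp_neg (Real.log C), Real.exp_log hC]
  rfl

/-! ### Bounds on the exponents -/

section Bounds

variable {X : Type*} [Fintype X]

theorem exp_le_numGuesses [Nonempty X] (α : ℝ) (n : ℕ) :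
    Real.exp (n * (α * Real.log (Fintype.card X))) ≤ numGuesses X α n := by
  have hX : (0 : ℝ) < Fintype.card X := by exact_mod_cast Fintype.card_pos
  refine le_trans (le_of_eq ?_) (Nat.le_ceil _)
  rw [Real.rpow_def_of_pos hX]
  congr 1
  ring

theorem numGuesses_le [Nonempty X] {α : ℝ} (hα : 0 ≤ α) (n : ℕ) :
    (numGuesses X α n : ℝ) ≤ 2 * Real.exp (n * (α * Real.log (Fintype.card X))) := by
  have hX : (1 : ℝ) ≤ Fintype.card X := by exact_mod_cast Fintype.card_pos
  have h1 : (1 : ℝ) ≤ (Fintype.card X : ℝ) ^ ((n : ℝ) * α) :=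
    Real.one_le_rpow hX (by positivity)
  have h2 : Real.exp (n * (α * Real.log (Fintype.card X)))
      = (Fintype.card X : ℝ) ^ ((n : ℝ) * α) := by
    rw [Real.rpow_def_of_pos (by linarith)]
    congr 1
    ring
  rw [h2, numGuesses]
  have := (Nat.ceil_lt_add_one (zero_le_one.trans h1)).le
  linarith

theorem card_mostLikely_le [Nonempty X] [MeasurableSpace X] (P : Measure X) {α : ℝ} (hα : 0 ≤ α)
    (n : ℕ) :
    ((mostLikely (secretLaw P n) (numGuesses X α n)).card : ℝ)
      ≤ 2 * Real.exp (n * (α * Real.log (Fintype.card X))) := by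
  refine le_trans ?_ (numGuesses_le hα n)
  rw [(mostLikely_spec (secretLaw P n) (numGuesses X α n)).1]
  exact_mod_cast min_le_left _ _

/-- The bound obtained by taking all guessed words to be as likely as the most likely one. -/
theorem le_syncExponent_of_weight_le [MeasurableSpace X] (P : Measure X)
    [IsProbabilityMeasure P] {α : ℝ} (hα : 0 ≤ α) {s : ℝ}
    (hs : ∀ a, weight P a ≤ Real.exp (-s)) :
    ((s - α * Real.log (Fintype.card X) : ℝ) : EReal) ≤ syncExponent P α := by
  have := nonempty_of_isProbabilityMeasure P
  refine le_exponent two_pos fun n => ?_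
  rw [syncSuccess_eq]
  refine ENNReal.ofReal_le_ofReal ?_
  calc ∑ x ∈ mostLikely (secretLaw P n) (numGuesses X α n), ∏ i, weight P (x i)
      ≤ ∑ x ∈ mostLikely (secretLaw P n) (numGuesses X α n), Real.exp (-s) ^ n := by
        refine Finset.sum_le_sum fun x _ => ?_
        refine (Finset.prod_le_prod (fun i _ => weight_nonneg P _) fun i _ => hs _).trans_eq ?_
        rw [Finset.prod_const, Finset.card_univ, Fintype.card_fin]
    _ ≤ 2 * Real.exp (n * (α * Real.log (Fintype.card X))) * Real.exp (-s) ^ n := by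
        rw [Finset.sum_const, nsmul_eq_mul]
        exact mul_le_mul_of_nonneg_right (card_mostLikely_le P hα n) (by positivity)
    _ = _ := by
        rw [← Real.exp_nat_mul, mul_assoc, ← Real.exp_add]
        congr 2
        ring

variable [MeasurableSpace X] [MeasurableSingletonClass X] (P : Measure X) [IsProbabilityMeasure P]

theorem syncExponent_nonneg (α : ℝ) : 0 ≤ syncExponent P α := by
  have := le_exponent (p := fun n => syncSuccess P n (numGuesses X α n)) (a := 0) one_pos
    fun n => by simpa using syncSuccess_le_one P n _
  rwa [EReal.coe_zero] at this

theorem syncExponent_le_asyncExponent (α β : ℝ) : syncExponent P α ≤ asyncExponent P α β :=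
  exponent_anti fun n => asyncSuccess_le_syncSuccess P β n _

/-- The words that are less likely than `exp (-n t)` contribute at most `J exp (-n t)`, the others
are controlled by the `β`-th moment of the probabilities. -/
theorem le_syncExponent_of_le {α : ℝ} (hα : 0 ≤ α) {β t : ℝ} (hβ : 1 ≤ β)
    (h : α * Real.log (Fintype.card X) ≤ β * t + Real.log (∑ a, weight P a ^ β)) :
    ((t - (β * t + Real.log (∑ a, weight P a ^ β)) : ℝ) : EReal) ≤ syncExponent P α := by
  have := nonempty_of_isProbabilityMeasure P
  have hZ := sum_rpow_pos (weight_nonneg P) (sum_weight P) β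
  set ψ := Real.log (∑ a, weight P a ^ β) with hψ
  refine le_exponent (C := 3) three_pos fun n => ?_
  rw [syncSuccess_eq]
  refine ENNReal.ofReal_le_ofReal ?_
  refine (sum_prod_le_card_mul_add (weight_nonneg P) hβ _ t).trans ?_
  have h1 : (∑ a, weight P a ^ β) ^ n = Real.exp (n * ψ) := by
    rw [Real.exp_nat_mul, hψ, Real.exp_log hZ]
  have h2 : Real.exp (n * (α * Real.log (Fintype.card X))) ≤ Real.exp (n * (β * t + ψ)) :=
    Real.exp_le_exp.2 (mul_le_mul_of_nonneg_left h n.cast_nonneg)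
  have h3 : Real.exp (n * (β * t + ψ)) * Real.exp (-(n * t))
      = Real.exp (-(n * (t - (β * t + ψ)))) := by
    rw [← Real.exp_add]; congr 1; ring
  have h4 : Real.exp (n * ((β - 1) * t)) * Real.exp (n * ψ)
      = Real.exp (-(n * (t - (β * t + ψ)))) := by
    rw [← Real.exp_add]; congr 1; ring
  rw [h1, h4]
  have h5 := mul_le_mul_of_nonneg_right ((card_mostLikely_le P hα n).trans
    (mul_le_mul_of_nonneg_left h2 two_pos.le)) (Real.exp_pos (-(n * t))).le
  rw [mul_assoc, h3] at h5
  linarith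

/-- Guessing from a tilted distribution whose entropy rate does not exceed that of the number of
guesses finds the secret with an exponent of at most the divergence of that distribution
from `P`. -/
theorem asyncExponent_le_of_entropy_le {α β : ℝ} (hβ : β ≠ 0)
    (h : ∑ a, Real.negMulLog (tiltWeight β (weight P) a) ≤ α * Real.log (Fintype.card X)) :
    asyncExponent P α β ≤ ((crossEntropy (tiltWeight β (weight P)) (weight P)
      - ∑ a, Real.negMulLog (tiltWeight β (weight P) a) : ℝ) : EReal) := by
  have := nonempty_of_isProbabilityMeasure P
  have hbound := fun n : ℕ => ENNReal.ofReal_le_ofReal <| exp_le_sum_prod_mul_one_sub_pow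
    (weight_nonneg P) (tiltWeight_nonneg (weight_nonneg P) β)
    (sum_tiltWeight (weight_nonneg P) (sum_weight P) β)
    (fun a => (tiltWeight_eq_zero_iff (weight_nonneg P) (sum_weight P) hβ a).2)
    ((Real.exp_le_exp.2 (mul_le_mul_of_nonneg_left h n.cast_nonneg)).trans
      (exp_le_numGuesses α n))
  exact exponent_le two_pos fun n => (hbound n).trans_eq (asyncSuccess_eq P β n _).symm

end Bounds

/-! ### Large tilts concentrate on the most likely letters -/

section MostLikelyLetters

variable {X : Type*} [Fintype X]

/-- The letters that are as likely as `a₀`. -/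
noncomputable def equallyLikely (p : X → ℝ) (a₀ : X) : Finset X :=
  {a | p a = p a₀}

theorem card_equallyLikely_pos (p : X → ℝ) (a₀ : X) : 0 < (equallyLikely p a₀).card :=
  Finset.card_pos.2 ⟨a₀, by simp [equallyLikely]⟩

theorem tiltWeight_eq_of_mem {p : X → ℝ} {a₀ a : X} (h : a ∈ equallyLikely p a₀) (β : ℝ) :
    tiltWeight β p a = tiltWeight β p a₀ := by
  rw [equallyLikely, Finset.mem_filter] at h
  rw [tiltWeight, h.2, tiltWeight]

theorem card_mul_tiltWeight_le_one {p : X → ℝ} (hp : ∀ a, 0 ≤ p a) (hp1 : ∑ a, p a = 1) (a₀ : X)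
    (β : ℝ) : (equallyLikely p a₀).card * tiltWeight β p a₀ ≤ 1 := by
  rw [← nsmul_eq_mul, ← Finset.sum_const, ← sum_tiltWeight hp hp1 β,
    ← Finset.sum_congr rfl fun a ha => tiltWeight_eq_of_mem ha β]
  exact Finset.sum_le_sum_of_subset_of_nonneg (Finset.subset_univ _)
    fun a _ _ => tiltWeight_nonneg hp β a

theorem tendsto_log_tiltWeight {p : X → ℝ} (hp : ∀ a, 0 ≤ p a) {a₀ : X} (ha₀ : 0 < p a₀)
    (hmax : ∀ a, p a ≤ p a₀) : Tendsto (fun β => Real.log (tiltWeight β p a₀)) atTop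
      (nhds (-Real.log (equallyLikely p a₀).card)) := by
  classical
  have hk : ((equallyLikely p a₀).card : ℝ) ≠ 0 := by
    exact_mod_cast (card_equallyLikely_pos p a₀).ne'
  have hterm : ∀ a, Tendsto (fun β : ℝ => (p a / p a₀) ^ β) atTop
      (nhds (if p a = p a₀ then 1 else 0)) := by
    intro a
    split_ifs with h
    · simp [h, div_self ha₀.ne']
    · refine tendsto_rpow_atTop_of_base_lt_one _ ?_ ?_
      · linarith [div_nonneg (hp a) ha₀.le]
      · exact (div_lt_one ha₀).2 (lt_of_le_of_ne (hmax a) h)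
  have hsum := tendsto_finsetSum Finset.univ fun a _ => hterm a
  have hcard : ∑ a, (if p a = p a₀ then (1 : ℝ) else 0) = (equallyLikely p a₀).card := by
    rw [equallyLikely, Finset.sum_boole]
  rw [hcard] at hsum
  have hlog := ((Real.continuousAt_log hk).tendsto.comp hsum).neg
  refine hlog.congr fun β => ?_
  have hd : ∀ a, (p a / p a₀) ^ β = p a ^ β / p a₀ ^ β := fun a =>
    Real.div_rpow (hp a) ha₀.le β
  simp only [Function.comp_apply, hd, tiltWeight]
  rw [← Finset.sum_div, ← Real.log_inv, inv_div]

end MostLikelyLetters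

/-! ### The case of an empty set of distributions -/

section Empty

variable {X : Type*} [Fintype X] [MeasurableSpace X] [MeasurableSingletonClass X]
  (P : Measure X) [IsProbabilityMeasure P]

theorem exists_forall_weight_le : ∃ a₀, 0 < weight P a₀ ∧ ∀ a, weight P a ≤ weight P a₀ := by
  have := nonempty_of_isProbabilityMeasure P
  obtain ⟨a₀, -, h⟩ := Finset.exists_max_image Finset.univ (weight P) Finset.univ_nonempty
  refine ⟨a₀, ?_, fun a => h a (Finset.mem_univ a)⟩
  obtain ⟨y, -, hy⟩ : ∃ y ∈ Finset.univ, weight P y ≠ 0 :=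
    Finset.exists_ne_zero_of_sum_ne_zero (by rw [sum_weight P]; exact one_ne_zero)
  exact (lt_of_le_of_ne (weight_nonneg P y) hy.symm).trans_le (h y (Finset.mem_univ y))

variable {P} in
/-- If `𝒬(α)` is empty, then the words of most likely letters are at least as many as
the guesses: otherwise, by Gibbs' inequality for a large tilt, all distributions of entropy at
least `α log |X|` have a cross entropy bounded away from the minimal one, which a point mass
attains. -/
theorem le_log_card_of_QSet_eq_empty {α : ℝ} (h : ¬ (QSet P α).Nonempty) {a₀ : X}
    (ha₀ : 0 < weight P a₀) (hmax : ∀ a, weight P a ≤ weight P a₀) :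
    α * Real.log (Fintype.card X) ≤ Real.log (equallyLikely (weight P) a₀).card := by
  classical
  by_contra! hlt
  apply h
  have hp := weight_nonneg P
  have hp1 := sum_weight P
  obtain ⟨β, hβ0, hβ⟩ := ((eventually_gt_atTop (0 : ℝ)).and
    ((tendsto_log_tiltWeight hp ha₀ hmax).eventually_const_lt (neg_lt_neg hlt))).exists
  have hlogt : Real.log (tiltWeight β (weight P) a₀)
      = β * Real.log (weight P a₀) - Real.log (∑ a, weight P a ^ β) := by
    rw [tiltWeight, Real.log_div (Real.rpow_pos_of_pos ha₀ _).ne' (sum_rpow_pos hp hp1 β).ne',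
      Real.log_rpow ha₀]
  obtain ⟨Q, hQ⟩ := exists_probabilityMeasure_weight_eq (q := Pi.single (M := fun _ => ℝ) a₀ 1)
    (fun a => by by_cases h : a = a₀ <;> simp [h]) (by simp)
  have hac : (Q : Measure X) ≪ P := by
    rw [absolutelyContinuous_iff_weight]
    intro a ha
    rw [hQ, Pi.single_apply, if_neg]
    rintro rfl
    exact ha₀.ne' ha
  have hce : crossEntropy (weight (Q : Measure X)) (weight P) = -Real.log (weight P a₀) := by
    simp [crossEntropy, hQ, Pi.single_apply]
  refine ⟨Q, ?_⟩
  rw [QSet, Set.mem_ofPred_eq, div_add_entropy_of_ac Q P hac, hce]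
  -- The gap that Gibbs' inequality leaves between feasible cross entropies and the minimal one.
  set δ := (α * Real.log (Fintype.card X) + Real.log (tiltWeight β (weight P) a₀)) / β with hδ
  have hδ0 : 0 < δ := div_pos (by linarith) hβ0
  refine lt_of_lt_of_le (b := ((-Real.log (weight P a₀) + δ : ℝ) : EReal))
    (EReal.coe_lt_coe_iff.2 (by linarith)) (le_iInf₂ fun R hR => ?_)
  by_cases hRac : (R : Measure X) ≪ P
  · rw [div_add_entropy_of_ac R P hRac, EReal.coe_le_coe_iff]
    have hgibbs := sum_negMulLog_le_mul_crossEntropy_add hp hp1 (weight_nonneg (R : Measure X))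
      (sum_weight (R : Measure X)) ((absolutelyContinuous_iff_weight _ _).1 hRac) hβ0.ne'
    have hR' : α * Real.log (Fintype.card X)
      ≤ ∑ a, Real.negMulLog (weight (R : Measure X) a) := hR
    have hδβ : δ * β = α * Real.log (Fintype.card X) + Real.log (tiltWeight β (weight P) a₀) :=
      div_mul_cancel₀ _ hβ0.ne'
    have := hR'.trans hgibbs
    nlinarith
  · rw [div_add_entropy_eq_top R P hRac]
    exact le_top

/-- The bound obtained from the secrets and guesses that consist of most likely letters. -/
theorem asyncExponent_le_of_le_log_card {α : ℝ} {a₀ : X} (ha₀ : 0 < weight P a₀)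
    (h : α * Real.log (Fintype.card X) ≤ Real.log (equallyLikely (weight P) a₀).card) (β : ℝ) :
    asyncExponent P α β ≤ ((-(Real.log (equallyLikely (weight P) a₀).card
      + Real.log (weight P a₀) + α * Real.log (Fintype.card X)
      + Real.log (tiltWeight β (weight P) a₀)) : ℝ) : EReal) := by
  have := nonempty_of_isProbabilityMeasure P
  have hp := weight_nonneg P
  have hp1 := sum_weight P
  set A := equallyLikely (weight P) a₀ with hA
  set κ := tiltWeight β (weight P) a₀ with hκ
  have hκ0 : 0 < κ := div_pos (Real.rpow_pos_of_pos ha₀ _) (sum_rpow_pos hp hp1 β)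
  have hk0 : (0 : ℝ) < A.card := by exact_mod_cast card_equallyLikely_pos (weight P) a₀
  have hκle : Real.log A.card + Real.log κ ≤ 0 := by
    rw [← Real.log_mul hk0.ne' hκ0.ne']
    exact Real.log_nonpos (by positivity) (card_mul_tiltWeight_le_one hp hp1 a₀ β)
  refine exponent_le (b := 0) two_pos fun n => ?_
  rw [asyncSuccess_eq]
  refine ENNReal.ofReal_le_ofReal ?_
  set J := numGuesses X α n
  have hr : ∀ x : Fin n → X, 0 ≤ ∏ i, tiltWeight β (weight P) (x i) := fun x =>
    Finset.prod_nonneg fun i _ => tiltWeight_nonneg hp β _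
  have hr1 : ∀ x : Fin n → X, ∏ i, tiltWeight β (weight P) (x i) ≤ 1 := fun x =>
    Finset.prod_le_one (fun i _ => tiltWeight_nonneg hp β _) fun i _ =>
      sum_tiltWeight hp hp1 β ▸
        Finset.single_le_sum (fun y _ => tiltWeight_nonneg hp β y) (Finset.mem_univ (x i))
  have hsucc : Real.exp (n * (α * Real.log (Fintype.card X) + Real.log κ)) / 2
      ≤ 1 - (1 - κ ^ n) ^ J := by
    have hκ1 : κ ≤ 1 := by
      rw [← sum_tiltWeight hp hp1 β]
      exact Finset.single_le_sum (fun y _ => tiltWeight_nonneg hp β y) (Finset.mem_univ a₀)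
    refine le_trans ?_ (min_div_two_le_one_sub_pow (pow_le_one₀ hκ0.le hκ1) J
      (pow_nonneg hκ0.le n))
    refine div_le_div_of_nonneg_right (le_min ?_ ?_) two_pos.le
    · exact Real.exp_le_one_iff.2 (mul_nonpos_of_nonneg_of_nonpos n.cast_nonneg (by linarith))
    · rw [mul_add, Real.exp_add, Real.exp_nat_mul (Real.log κ), Real.exp_log hκ0]
      exact mul_le_mul_of_nonneg_right (exp_le_numGuesses α n) (pow_nonneg hκ0.le n)
  calc _ = ∑ x ∈ Fintype.piFinset fun _ : Fin n => A, weight P a₀ ^ n *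
        (Real.exp (n * (α * Real.log (Fintype.card X) + Real.log κ)) / 2) := by
        rw [Finset.sum_const, Fintype.card_piFinset_const, nsmul_eq_mul, Nat.cast_pow,
          ← Real.exp_log (pow_pos hk0 n), ← Real.exp_log (pow_pos ha₀ n), Real.log_pow,
          Real.log_pow, ← mul_assoc, ← Real.exp_add, ← mul_div_assoc, ← Real.exp_add]
        congr 2
        ring
    _ ≤ ∑ x ∈ Fintype.piFinset fun _ : Fin n => A, (∏ i, weight P (x i)) *
        (1 - (1 - ∏ i, tiltWeight β (weight P) (x i)) ^ J) := by
        refine Finset.sum_le_sum fun x hx => ?_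
        rw [Fintype.mem_piFinset] at hx
        have h1 : ∏ i, weight P (x i) = weight P a₀ ^ n := by
          rw [Finset.prod_congr rfl fun i _ => (Finset.mem_filter.1 (hx i)).2]
          simp
        have h2 : ∏ i, tiltWeight β (weight P) (x i) = κ ^ n := by
          rw [Finset.prod_congr rfl fun i _ => tiltWeight_eq_of_mem (hx i) β]
          simp [hκ]
        rw [h1, h2]
        exact mul_le_mul_of_nonneg_left hsucc (pow_nonneg ha₀.le n)
    _ ≤ _ := Finset.sum_le_sum_of_subset_of_nonneg (Finset.subset_univ _) fun x _ _ =>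
        mul_nonneg (Finset.prod_nonneg fun i _ => hp _)
          (sub_nonneg.2 (pow_le_one₀ (sub_nonneg.2 (hr1 x)) (sub_le_self _ (hr x))))

theorem isGLB_asyncExponent_of_QSet_eq_empty {α : ℝ} (hα : 0 ≤ α) (h : ¬ (QSet P α).Nonempty) :
    IsGLB ((fun β : ℝ => asyncExponent P α β) '' Set.Ici 0) (syncExponent P α) := by
  obtain ⟨a₀, ha₀, hmax⟩ := exists_forall_weight_le P
  have hcard := le_log_card_of_QSet_eq_empty h ha₀ hmax
  refine ⟨?_, fun b hb => ?_⟩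
  · rintro _ ⟨β, -, rfl⟩
    exact syncExponent_le_asyncExponent P α β
  · refine le_trans ?_ (le_syncExponent_of_weight_le P hα (s := -Real.log (weight P a₀))
      fun a => by rw [neg_neg, Real.exp_log ha₀]; exact hmax a)
    have hlim := ((tendsto_log_tiltWeight (weight_nonneg P) ha₀ hmax).const_add
      (Real.log (equallyLikely (weight P) a₀).card + Real.log (weight P a₀)
        + α * Real.log (Fintype.card X))).neg
    rw [show -(Real.log (equallyLikely (weight P) a₀).card + Real.log (weight P a₀)
        + α * Real.log (Fintype.card X) + -Real.log (equallyLikely (weight P) a₀).card)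
      = -Real.log (weight P a₀) - α * Real.log (Fintype.card X) by ring] at hlim
    refine ge_of_tendsto ((continuous_coe_real_ereal.tendsto _).comp hlim) ?_
    filter_upwards [eventually_ge_atTop (0 : ℝ)] with β hβ
    exact (hb ⟨β, hβ, rfl⟩).trans (asyncExponent_le_of_le_log_card P ha₀ hcard β)

end Empty

/-! ### The case of a nonempty set of distributions -/

section Nonempty

theorem ac_of_mem_QSet {X : Type*} [Fintype X] [MeasurableSpace X] {P : Measure X}
    {α : ℝ} {Q : ProbabilityMeasure X} (h : Q ∈ QSet P α) :
    (Q : Measure X) ≪ P := by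
  by_contra hac
  rw [QSet, Set.mem_ofPred_eq, div_add_entropy_eq_top Q P hac] at h
  exact not_top_lt h

variable {X : Type*} [Fintype X] [MeasurableSpace X] [MeasurableSingletonClass X]
  {P : Measure X} [IsProbabilityMeasure P]

/-- On the segment between two distributions the cross entropy is affine, and the entropy is at
least its share at one of the end points. -/
theorem exists_mixture {Q₁ Q₂ : ProbabilityMeasure X} (h₁ : (Q₁ : Measure X) ≪ P)
    (h₂ : (Q₂ : Measure X) ≪ P) {ε : ℝ} (hε0 : 0 ≤ ε) (hε1 : ε ≤ 1) :
    ∃ Q : ProbabilityMeasure X, (Q : Measure X) ≪ P ∧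
      crossEntropy (weight (Q : Measure X)) (weight P)
        = (1 - ε) * crossEntropy (weight (Q₁ : Measure X)) (weight P)
          + ε * crossEntropy (weight (Q₂ : Measure X)) (weight P) ∧
      (1 - ε) * entropy Q₁ ≤ entropy Q := by
  have hε1' : 0 ≤ 1 - ε := sub_nonneg.2 hε1
  obtain ⟨Q, hQ⟩ := exists_probabilityMeasure_weight_eq
    (q := fun a => (1 - ε) * weight (Q₁ : Measure X) a + ε * weight (Q₂ : Measure X) a)
    (fun a => add_nonneg (mul_nonneg hε1' (weight_nonneg _ a)) (mul_nonneg hε0 (weight_nonneg _ a)))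
    (by rw [Finset.sum_add_distrib, ← Finset.mul_sum, ← Finset.mul_sum, sum_weight, sum_weight]
        ring)
  rw [absolutelyContinuous_iff_weight] at h₁ h₂
  refine ⟨Q, (absolutelyContinuous_iff_weight _ _).2 fun a ha => ?_, ?_, ?_⟩
  · rw [hQ, h₁ a ha, h₂ a ha]
    ring
  · simp only [crossEntropy, hQ, add_mul, Finset.sum_add_distrib, mul_assoc, ← Finset.mul_sum]
    ring
  · have hent : ∀ R : ProbabilityMeasure X,
      entropy R = ∑ a, Real.negMulLog (weight (R : Measure X) a) := fun _ => rfl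
    rw [hent, hent, Finset.mul_sum]
    refine Finset.sum_le_sum fun a _ => ?_
    have hconc := Real.concaveOn_negMulLog.2 (Set.mem_Ici.2 (weight_nonneg (Q₁ : Measure X) a))
      (Set.mem_Ici.2 (weight_nonneg (Q₂ : Measure X) a)) hε1' hε0 (sub_add_cancel 1 ε)
    have hnn := mul_nonneg hε0 (Real.negMulLog_nonneg (weight_nonneg (Q₂ : Measure X) a)
      (weight_le_one (Q₂ : Measure X) a))
    rw [hQ]
    simp only [smul_eq_mul] at hconc
    linarith

/-- If `𝒬(α)` is nonempty, then the distributions of cross entropy at most `t(α)` have entropy at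
most `α log |X|`: otherwise, one could move slightly towards an element of `𝒬(α)`, decreasing the
cross entropy below `t(α)`, without leaving the feasible set. -/
theorem entropy_le_of_mem_closedQSet {α : ℝ} (hα : 0 ≤ α) (hne : (QSet P α).Nonempty)
    {Q : ProbabilityMeasure X} (hac : (Q : Measure X) ≪ P) (hQ : Q ∈ closedQSet P α) :
    entropy Q ≤ α * Real.log (Fintype.card X) := by
  obtain ⟨Q₀, hQ₀⟩ := hne
  have hac₀ := ac_of_mem_QSet hQ₀
  by_contra! hlt
  have hc : 0 ≤ α * Real.log (Fintype.card X) := mul_nonneg hα (Real.log_natCast_nonneg _)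
  have hH : 0 < entropy Q := hc.trans_lt hlt
  -- This weight of `Q₀` leaves the share of `Q` in the entropy exactly at the feasible value.
  set ε := 1 - α * Real.log (Fintype.card X) / entropy Q with hε
  have hε0 : 0 < ε := sub_pos.2 ((div_lt_one hH).2 hlt)
  have hε1 : ε ≤ 1 := sub_le_self _ (div_nonneg hc hH.le)
  obtain ⟨R, hRac, hRce, hRH⟩ := exists_mixture hac hac₀ hε0.le hε1
  have hfeas : α * Real.log (Fintype.card X) ≤ entropy R := by
    rwa [hε, sub_sub_cancel, div_mul_cancel₀ _ hH.ne'] at hRH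
  have ht : threshold P α ≤ div R P + (entropy R : EReal) := iInf₂_le R hfeas
  rw [div_add_entropy_of_ac R P hRac, hRce] at ht
  rw [closedQSet, Set.mem_ofPred_eq, div_add_entropy_of_ac Q P hac] at hQ
  rw [QSet, Set.mem_ofPred_eq, div_add_entropy_of_ac Q₀ P hac₀] at hQ₀
  have h1 := EReal.coe_le_coe_iff.1 (hQ.trans ht)
  have h2 := EReal.coe_lt_coe_iff.1 (hQ₀.trans_le ht)
  nlinarith

/-- The tilted letter distribution that asynchronous guessers should use: either `P` itself, or
the tilted distribution whose cross entropy is the threshold. -/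
theorem exists_tilt_crossEntropy_le {α : ℝ} (hne : (QSet P α).Nonempty) :
    ∃ β : ℝ, 1 ≤ β ∧
      (crossEntropy (tiltWeight β (weight P)) (weight P) : EReal) ≤ threshold P α ∧
      (β = 1 ∨ threshold P α = crossEntropy (tiltWeight β (weight P)) (weight P)) := by
  have hp := weight_nonneg P
  have hp1 := sum_weight P
  by_cases h : (crossEntropy (weight P) (weight P) : EReal) ≤ threshold P α
  · exact ⟨1, le_rfl, by rwa [tiltWeight_one hp1], Or.inl rfl⟩
  obtain ⟨Q₀, hQ₀⟩ := hne
  have hac₀ := ac_of_mem_QSet hQ₀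
  rw [QSet, Set.mem_ofPred_eq, div_add_entropy_of_ac Q₀ P hac₀] at hQ₀
  rw [not_le] at h
  lift threshold P α to ℝ using ⟨(h.trans (EReal.coe_lt_top _)).ne,
    ((EReal.bot_lt_coe _).trans hQ₀).ne'⟩ with t
  rw [EReal.coe_lt_coe_iff] at h hQ₀
  set c := crossEntropy (weight (Q₀ : Measure X)) (weight P)
  -- A tilt so large that `crossEntropy_tiltWeight_le` puts the cross entropy below `t`.
  set B := max 1 (Real.log (Fintype.card X) / (t - c)) with hB
  have hB1 : 1 ≤ B := le_max_left _ _
  have htc : 0 < t - c := sub_pos.2 hQ₀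
  have hlow : crossEntropy (tiltWeight B (weight P)) (weight P) ≤ t := by
    refine (crossEntropy_tiltWeight_le hp hp1 (weight_nonneg (Q₀ : Measure X))
      (sum_weight (Q₀ : Measure X)) ((absolutelyContinuous_iff_weight _ _).1 hac₀)
      (by linarith)).trans ?_
    have : Real.log (Fintype.card X) / B ≤ t - c := by
      rw [div_le_comm₀ (by linarith) htc]
      exact le_max_right _ _
    linarith
  have hcont : ContinuousOn (fun β => crossEntropy (tiltWeight β (weight P)) (weight P))
      (Set.Icc 1 B) :=
    (continuousOn_crossEntropy_tiltWeight hp hp1).mono fun β hβ => one_pos.trans_le hβ.1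
  obtain ⟨β, hβ, hβt⟩ := intermediate_value_Icc' hB1 hcont
    (show t ∈ _ from ⟨hlow, by simpa only [tiltWeight_one hp1] using h.le⟩)
  simp only at hβt
  exact ⟨β, hβ.1, by rw [hβt], Or.inr (by rw [hβt])⟩

/-- The tilted distribution as an element of the space of probability measures. -/
noncomputable def tiltProb (β : ℝ) (P : Measure X) [IsProbabilityMeasure P] :
    ProbabilityMeasure X :=
  ⟨tilt β P, inferInstance⟩

theorem weight_tiltProb (β : ℝ) :
    weight (tiltProb β P : Measure X) = tiltWeight β (weight P) :=
  funext fun a => weight_tilt β P a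

theorem entropy_tiltProb (β : ℝ) :
    entropy (tiltProb β P) = ∑ a, Real.negMulLog (tiltWeight β (weight P) a) := by
  rw [← weight_tiltProb]
  rfl

theorem tiltProb_ac {β : ℝ} (hβ : β ≠ 0) : (tiltProb β P : Measure X) ≪ P := by
  rw [absolutelyContinuous_iff_weight, weight_tiltProb]
  exact fun a => (tiltWeight_eq_zero_iff (weight_nonneg P) (sum_weight P) hβ a).2

theorem div_tiltProb_one : div (tiltProb 1 P) P = 0 := by
  rw [div_eq_of_ac _ _ (tiltProb_ac one_ne_zero), entropy_tiltProb, weight_tiltProb,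
    tiltWeight_one (sum_weight P), crossEntropy_self, sub_self, EReal.coe_zero]

/-- For the tilted distribution of cross entropy `t(α)`, the divergence from `P` is minimal among
the distributions of cross entropy at most `t(α)`. -/
theorem div_tiltProb_le {α β : ℝ} (hβ : 1 ≤ β)
    (h : β = 1 ∨ threshold P α = crossEntropy (tiltWeight β (weight P)) (weight P))
    {Q : ProbabilityMeasure X} (hQ : Q ∈ closedQSet P α) : div (tiltProb β P) P ≤ div Q P := by
  have hβ0 : β ≠ 0 := by positivity
  rcases h with rfl | h
  · rw [div_tiltProb_one]
    exact EReal.coe_ennreal_nonneg _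
  · by_cases hac : (Q : Measure X) ≪ P
    · rw [closedQSet, Set.mem_ofPred_eq, div_add_entropy_of_ac Q P hac, h,
        EReal.coe_le_coe_iff] at hQ
      rw [div_eq_of_ac Q P hac, div_eq_of_ac _ P (tiltProb_ac hβ0), EReal.coe_le_coe_iff,
        entropy_tiltProb, weight_tiltProb,
        sum_negMulLog_tiltWeight (weight_nonneg P) (sum_weight P) hβ0]
      have hgibbs : entropy Q ≤ _ :=
        sum_negMulLog_le_mul_crossEntropy_add (weight_nonneg P) (sum_weight P)
          (weight_nonneg (Q : Measure X)) (sum_weight (Q : Measure X))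
          ((absolutelyContinuous_iff_weight _ _).1 hac) hβ0
      nlinarith
    · rw [div_eq_top Q P hac]
      exact le_top

theorem div_tiltProb_le_syncExponent {α β : ℝ} (hα : 0 ≤ α) (hβ : 1 ≤ β)
    (h : β = 1 ∨ threshold P α = crossEntropy (tiltWeight β (weight P)) (weight P)) :
    div (tiltProb β P) P ≤ syncExponent P α := by
  have hβ0 : β ≠ 0 := by positivity
  rcases h with rfl | h
  · rw [div_tiltProb_one]
    exact syncExponent_nonneg P α
  · rw [div_eq_of_ac _ P (tiltProb_ac hβ0), entropy_tiltProb, weight_tiltProb,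
      sum_negMulLog_tiltWeight (weight_nonneg P) (sum_weight P) hβ0]
    refine le_syncExponent_of_le P hα hβ ?_
    -- Gibbs' inequality bounds the cross entropy of every feasible distribution from below.
    set ψ := Real.log (∑ a, weight P a ^ β)
    have hle : (((α * Real.log (Fintype.card X) - ψ) / β : ℝ) : EReal) ≤ threshold P α := by
      refine le_iInf₂ fun R hR => ?_
      by_cases hac : (R : Measure X) ≪ P
      · rw [div_add_entropy_of_ac R P hac, EReal.coe_le_coe_iff, div_le_iff₀' (by linarith)]
        have hgibbs : entropy R ≤ _ :=
          sum_negMulLog_le_mul_crossEntropy_add (weight_nonneg P) (sum_weight P)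
            (weight_nonneg (R : Measure X)) (sum_weight (R : Measure X))
            ((absolutelyContinuous_iff_weight _ _).1 hac) hβ0
        linarith
      · rw [div_add_entropy_eq_top R P hac]
        exact le_top
    rw [h, EReal.coe_le_coe_iff, div_le_iff₀' (by linarith)] at hle
    linarith

theorem isGLB_div_QSet {α : ℝ} (hne : (QSet P α).Nonempty) {Q₁ : ProbabilityMeasure X}
    (hac₁ : (Q₁ : Measure X) ≪ P) (hQ₁ : Q₁ ∈ closedQSet P α)
    (hmin : ∀ Q ∈ closedQSet P α, div Q₁ P ≤ div Q P) :
    IsGLB ((fun Q => div Q P) '' QSet P α) (div Q₁ P) := by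
  refine ⟨?_, fun b hb => ?_⟩
  · rintro _ ⟨Q, hQ, rfl⟩
    refine hmin Q ?_
    rw [QSet, Set.mem_ofPred_eq] at hQ
    exact hQ.le
  obtain ⟨Q₀, hQ₀⟩ := hne
  have hac₀ := ac_of_mem_QSet hQ₀
  rw [closedQSet, Set.mem_ofPred_eq, div_add_entropy_of_ac Q₁ P hac₁] at hQ₁
  rw [QSet, Set.mem_ofPred_eq, div_add_entropy_of_ac Q₀ P hac₀] at hQ₀
  rw [div_eq_of_ac Q₁ P hac₁]
  set c₁ := crossEntropy (weight (Q₁ : Measure X)) (weight P)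
  set c₀ := crossEntropy (weight (Q₀ : Measure X)) (weight P)
  have hlim : Tendsto (fun ε : ℝ => (1 - ε) * (c₁ - entropy Q₁) + ε * c₀)
      (nhdsWithin 0 (Set.Ioi 0)) (nhds (c₁ - entropy Q₁)) := by
    have hc : Continuous fun ε : ℝ => (1 - ε) * (c₁ - entropy Q₁) + ε * c₀ := by fun_prop
    have := (hc.tendsto 0).mono_left (nhdsWithin_le_nhds (s := Set.Ioi 0))
    simpa using this
  refine ge_of_tendsto ((continuous_coe_real_ereal.tendsto _).comp hlim) ?_
  filter_upwards [Ioo_mem_nhdsGT one_pos] with ε hε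
  obtain ⟨R, hRac, hRce, hRH⟩ := exists_mixture hac₁ hac₀ hε.1.le hε.2.le
  have hR : R ∈ QSet P α := by
    rw [QSet, Set.mem_ofPred_eq, div_add_entropy_of_ac R P hRac, hRce]
    -- If `c₁ ≤ c₀`, the mixture is below `c₀`, otherwise it is strictly below `c₁`.
    rcases le_or_gt c₁ c₀ with hc | hc
    · refine lt_of_le_of_lt (EReal.coe_le_coe_iff.2 ?_) hQ₀
      nlinarith [hε.2]
    · refine lt_of_lt_of_le (EReal.coe_lt_coe_iff.2 ?_) hQ₁
      nlinarith [hε.1]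
  refine (hb ⟨R, hR, rfl⟩).trans ?_
  simp only [Function.comp_apply]
  rw [div_eq_of_ac R P hRac, EReal.coe_le_coe_iff, hRce]
  linarith

end Nonempty

end Guesswork

theorem corollary3 {X : Type*} [Fintype X] [MeasurableSpace X] [MeasurableSingletonClass X]
    (P : Measure X) [IsProbabilityMeasure P] (α : ℝ) (hα : 0 ≤ α) :
    IsGLB ((fun β : ℝ => Guesswork.asyncExponent P α β) '' Set.Ici 0)
        (Guesswork.syncExponent P α) ∧
      ((Guesswork.QSet P α).Nonempty →
        IsLeast ((fun β : ℝ => Guesswork.asyncExponent P α β) '' Set.Ici 0)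
            (Guesswork.syncExponent P α) ∧
          IsGLB ((fun Q => Guesswork.div Q P) '' Guesswork.QSet P α)
            (Guesswork.syncExponent P α) ∧
          IsLeast ((fun Q => Guesswork.div Q P) '' Guesswork.closedQSet P α)
            (Guesswork.syncExponent P α)) := by
  have hmain : (Guesswork.QSet P α).Nonempty →
      IsLeast ((fun β : ℝ => Guesswork.asyncExponent P α β) '' Set.Ici 0)
          (Guesswork.syncExponent P α) ∧
        IsGLB ((fun Q => Guesswork.div Q P) '' Guesswork.QSet P α)
          (Guesswork.syncExponent P α) ∧
        IsLeast ((fun Q => Guesswork.div Q P) '' Guesswork.closedQSet P α)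
          (Guesswork.syncExponent P α) := by
    intro hne
    obtain ⟨β, hβ, hle, hor⟩ := Guesswork.exists_tilt_crossEntropy_le hne
    have hβ0 : β ≠ 0 := by positivity
    have hac := Guesswork.tiltProb_ac (P := P) hβ0
    have hmem : Guesswork.tiltProb β P ∈ Guesswork.closedQSet P α := by
      rw [Guesswork.closedQSet, Set.mem_ofPred_eq, Guesswork.div_add_entropy_of_ac _ P hac,
        Guesswork.weight_tiltProb]
      exact hle
    have hH := Guesswork.entropy_le_of_mem_closedQSet hα hne hac hmem
    have hasync : Guesswork.asyncExponent P α β ≤ Guesswork.div (Guesswork.tiltProb β P) P := by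
      rw [Guesswork.div_eq_of_ac _ P hac, Guesswork.entropy_tiltProb, Guesswork.weight_tiltProb]
      rw [Guesswork.entropy_tiltProb] at hH
      exact Guesswork.asyncExponent_le_of_entropy_le P hβ0 hH
    have hsync := Guesswork.div_tiltProb_le_syncExponent hα hβ hor
    have hle' := Guesswork.syncExponent_le_asyncExponent P α β
    have hD : Guesswork.syncExponent P α = Guesswork.div (Guesswork.tiltProb β P) P :=
      le_antisymm (hle'.trans hasync) hsync
    have hmin : ∀ Q ∈ Guesswork.closedQSet P α,
        Guesswork.div (Guesswork.tiltProb β P) P ≤ Guesswork.div Q P :=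
      fun Q hQ => Guesswork.div_tiltProb_le hβ hor hQ
    refine ⟨⟨⟨β, zero_le_one.trans hβ, le_antisymm (hasync.trans hsync) hle'⟩, ?_⟩, ?_, ?_, ?_⟩
    · rintro _ ⟨γ, -, rfl⟩
      exact Guesswork.syncExponent_le_asyncExponent P α γ
    · rw [hD]
      exact Guesswork.isGLB_div_QSet hne hac hmem hmin
    · exact ⟨_, hmem, hD.symm⟩
    · rintro _ ⟨Q, hQ, rfl⟩
      rw [hD]
      exact hmin Q hQ
  refine ⟨?_, hmain⟩
  by_cases hne : (Guesswork.QSet P α).Nonempty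
  · exact (hmain hne).1.isGLB
  · exact Guesswork.isGLB_asyncExponent_of_QSet_eq_empty P hα hne
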